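/- For a function $g:\{0,1\}^n\to\mathbb R$ let $\mathbb E g=2^{-n}\sum_{x}g(x)$, and for $S\subseteq\{1,\dots,n\}$ let $\widehat g(S)=\mathbb E\,[g(x)(-1)^{\sum_{i\in S}x_i}]$. For $g\ge 0$ let $\mathrm{Ent}(g)=\mathbb E[g\log_2 g]-(\mathbb E g)\log_2(\mathbb E g)$, with $0\log_2 0=0$. For $0\le\epsilon\le 1/2$ let $(T_\epsilon g)(x)=\mathbb E\,g(Y)$, where $Y$ is obtained from $x$ by flipping each coordinate independently with probability $\epsilon$. **Lemma 1.3.** There exist absolute constants $C_1,C_2>0$ such that for every $n\ge 0$, every nonnegative, not identically zero function $f:\{0,1\}^n\to\mathbb R$ and every $0\le\epsilon\le 1/2$, with $\lambda=(1-2\epsilon)^2$, $$\mathrm{Ent}(T_\epsilon f)\;\le\;\frac{1}{\mathbb E f}\left(\frac{1}{2\ln 2}\sum_{k=1}^n\widehat f(\{k\})^2\right)\lambda\;+\;C_1\,\frac{\mathbb E [f^2]}{\mathbb E f}\,\lambda^{4/3}\;+\;C_2\,\frac{(\mathbb E [f^2])^2}{(\mathbb E f)^3}\,\lambda^2 .$$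 -/

import Mathlib

noncomputable section

namespace BoolCube

/-- The expectation `E f` of a function on the cube `{0,1}^n` under the uniform measure. -/
def expect {n : ℕ} (f : (Fin n → Bool) → ℝ) : ℝ :=
  (∑ x, f x) / 2 ^ n

/-- The Walsh character `W_S(x) = (-1)^{∑_{i ∈ S} x_i}`. -/
def walsh {n : ℕ} (S : Finset (Fin n)) (x : Fin n → Bool) : ℝ :=
  ∏ i ∈ S, (if x i then (-1 : ℝ) else 1)

/-- The Fourier coefficient of `f` at `S`, namely `E (f * W_S)`. -/
def fourier {n : ℕ} (f : (Fin n → Bool) → ℝ) (S : Finset (Fin n)) : ℝ :=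
  expect fun x => f x * walsh S x

/-- The noise operator: `(T_ε f)(x) = E f(Y)`, where `Y` is obtained from `x` by flipping each
coordinate independently with probability `ε`. -/
def noise {n : ℕ} (ε : ℝ) (f : (Fin n → Bool) → ℝ) (x : Fin n → Bool) : ℝ :=
  ∑ y, (∏ i, (if y i = x i then 1 - ε else ε)) * f y

/-- The entropy `Ent f = E (f log₂ f) - (E f) log₂ (E f)` of a nonnegative function on the cube
(with `0 log₂ 0 = 0`, which `Real.logb` gives). -/
def ent {n : ℕ} (f : (Fin n → Bool) → ℝ) : ℝ :=
  expect (fun x => f x * Real.logb 2 (f x)) - expect f * Real.logb 2 (expect f)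

end BoolCube

end

namespace BoolCube

variable {n : ℕ}

/-! Both sides are homogeneous of degree one, so take `E f = 1` and write `T_ε f = 1 + h` with `E h
= 0`. Let `A = E f²`, and split `h = l + q` into its degree-one part and its part of degree at least
two. Pointwise, `(1 + h) ln (1 + h) ≤ h + h²/2 - h³/6 + h⁴/3` (`one_add_mul_log_le`). The quadratic
term gives the main term plus `E q²/2`, and `E q² ≤ λ² A`. If `3λ ≤ 1`, Bonami's inequality
(`expect_walshSum_pow_four_le`) bounds `E h⁴` and `E l⁴` by `9 λ² A²`. The cubic term needs a
cancellation: `E l³ = 0` by oddness, and `neg_cube_le` bounds `l³ - h³` by `q²`, `h⁴` and `l⁴`. If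
`3λ ≥ 1`, the crude bound `A ≤ 9 λ² A` is enough. Every error is thus of order `λ²`; the exponent
`4/3` enters only through `λ² ≤ λ^(4/3)`. -/

/-! ### Expectation on the cube. -/

lemma expect_add (f g : (Fin n → Bool) → ℝ) :
    expect (fun x => f x + g x) = expect f + expect g := by
  simp only [expect, Finset.sum_add_distrib, add_div]

lemma expect_const_mul (a : ℝ) (f : (Fin n → Bool) → ℝ) :
    expect (fun x => a * f x) = a * expect f := by
  simp only [expect, ← Finset.mul_sum, mul_div_assoc]

lemma expect_const (a : ℝ) : expect (fun _ : Fin n → Bool => a) = a := by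
  simp [expect]

lemma expect_mono {f g : (Fin n → Bool) → ℝ} (h : ∀ x, f x ≤ g x) : expect f ≤ expect g := by
  unfold expect
  gcongr
  exact h _

lemma expect_nonneg {f : (Fin n → Bool) → ℝ} (h : ∀ x, 0 ≤ f x) : 0 ≤ expect f :=
  div_nonneg (Finset.sum_nonneg fun x _ => h x) (by positivity)

lemma expect_pos {f : (Fin n → Bool) → ℝ} (h : ∀ x, 0 ≤ f x) (hf : f ≠ 0) : 0 < expect f := by
  obtain ⟨x, hx⟩ := Function.ne_iff.mp hf
  exact div_pos (Finset.sum_pos' (fun x _ => h x)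
    ⟨x, Finset.mem_univ x, lt_of_le_of_ne (h x) (Ne.symm hx)⟩) (by positivity)

lemma expect_mul_sq_le (f g : (Fin n → Bool) → ℝ) :
    expect (fun x => f x * g x) ^ 2 ≤ expect (fun x => f x ^ 2) * expect (fun x => g x ^ 2) := by
  unfold expect
  rw [div_pow, div_mul_div_comm, ← sq]
  gcongr
  exact Finset.sum_mul_sq_le_sq_mul_sq _ _ _

lemma expect_comp_perm (e : Equiv.Perm (Fin n → Bool)) (f : (Fin n → Bool) → ℝ) :
    expect (fun x => f (e x)) = expect f := by
  unfold expect
  rw [Equiv.sum_comp e f]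

/-- A function on the cube that a permutation of the points negates has mean zero. -/
lemma expect_eq_zero_of_comp_perm (e : Equiv.Perm (Fin n → Bool)) {f : (Fin n → Bool) → ℝ}
    (h : ∀ x, f (e x) = -f x) : expect f = 0 := by
  have h1 := expect_comp_perm e f
  have h2 := expect_const_mul (-1) f
  simp only [h] at h1
  simp only [neg_one_mul] at h2
  linarith

/-! ### Coordinate flips and Walsh characters. -/

/-- The permutation of the cube that flips the coordinate `i`. -/
def flipAt (i : Fin n) : Equiv.Perm (Fin n → Bool) :=
  Function.Involutive.toPerm (fun x => Function.update x i (!x i)) fun x => by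
    ext j
    by_cases hj : j = i
    · subst hj; simp
    · simp [hj]

/-- The permutation of the cube that flips all coordinates. -/
def flipAll : Equiv.Perm (Fin n → Bool) :=
  Function.Involutive.toPerm (fun x i => !x i) fun x => by simp

lemma flipAt_apply (i : Fin n) (x : Fin n → Bool) : flipAt i x = Function.update x i (!x i) := rfl

lemma flipAll_apply (x : Fin n → Bool) (i : Fin n) : flipAll x i = !x i := rfl

lemma walsh_flipAt_of_notMem {i : Fin n} {S : Finset (Fin n)} (h : i ∉ S) (x : Fin n → Bool) :
    walsh S (flipAt i x) = walsh S x := by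
  refine Finset.prod_congr rfl fun j hj => ?_
  have hji : j ≠ i := fun e => h (e ▸ hj)
  simp [flipAt_apply, hji]

lemma walsh_singleton_flipAt (i : Fin n) (x : Fin n → Bool) :
    walsh {i} (flipAt i x) = -walsh {i} x := by
  cases hx : x i <;> simp [walsh, flipAt_apply, hx]

lemma walsh_singleton_sq (i : Fin n) (x : Fin n → Bool) : walsh {i} x ^ 2 = 1 := by
  cases hx : x i <;> simp [walsh, hx]

lemma walsh_flipAll (S : Finset (Fin n)) (x : Fin n → Bool) :
    walsh S (flipAll x) = (-1) ^ S.card * walsh S x := by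
  rw [walsh, walsh, ← Finset.prod_const, ← Finset.prod_mul_distrib]
  refine Finset.prod_congr rfl fun i _ => ?_
  cases hx : x i <;> simp [flipAll_apply, hx]

lemma walsh_insert {i : Fin n} {S : Finset (Fin n)} (h : i ∉ S) (x : Fin n → Bool) :
    walsh (insert i S) x = walsh {i} x * walsh S x := by
  simp [walsh, Finset.prod_insert h]

/-! ### Multilinear polynomials: Parseval and hypercontractivity. -/

/-- The multilinear polynomial with coefficients `c S` for `S ⊆ J`. -/
def walshSum (J : Finset (Fin n)) (c : Finset (Fin n) → ℝ) (x : Fin n → Bool) : ℝ :=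
  ∑ S ∈ J.powerset, c S * walsh S x

lemma walshSum_flipAt {i : Fin n} {J : Finset (Fin n)} (h : i ∉ J) (c : Finset (Fin n) → ℝ)
    (x : Fin n → Bool) : walshSum J c (flipAt i x) = walshSum J c x :=
  Finset.sum_congr rfl fun S hS => by
    rw [walsh_flipAt_of_notMem fun hi => h (Finset.mem_powerset.mp hS hi)]

lemma walshSum_insert {i : Fin n} {J : Finset (Fin n)} (h : i ∉ J) (c : Finset (Fin n) → ℝ)
    (x : Fin n → Bool) : walshSum (insert i J) c x =
      walshSum J c x + walsh {i} x * walshSum J (fun S => c (insert i S)) x := by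
  unfold walshSum
  rw [Finset.sum_powerset_insert h, Finset.mul_sum]
  congr 1
  refine Finset.sum_congr rfl fun S hS => ?_
  rw [walsh_insert fun hi => h (Finset.mem_powerset.mp hS hi)]
  ring

/-- Parseval's identity. -/
lemma expect_walshSum_sq (J : Finset (Fin n)) (c : Finset (Fin n) → ℝ) :
    expect (fun x => walshSum J c x ^ 2) = ∑ S ∈ J.powerset, c S ^ 2 := by
  induction J using Finset.induction_on generalizing c with
  | empty => simp [walshSum, walsh, expect_const]
  | insert i J hi ih =>
    have hodd : expect (fun x =>
        walsh {i} x * (walshSum J c x * walshSum J (fun S => c (insert i S)) x)) = 0 :=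
      expect_eq_zero_of_comp_perm (flipAt i) fun x => by
        simp only [walsh_singleton_flipAt, walshSum_flipAt hi]; ring
    have key : (fun x => walshSum (insert i J) c x ^ 2) = fun x =>
        (walshSum J c x ^ 2 + walshSum J (fun S => c (insert i S)) x ^ 2) +
        2 * (walsh {i} x * (walshSum J c x * walshSum J (fun S => c (insert i S)) x)) := by
      funext x
      rw [walshSum_insert hi]
      linear_combination walshSum J (fun S => c (insert i S)) x ^ 2 * walsh_singleton_sq i x
    rw [key, expect_add, expect_add, expect_const_mul, hodd, ih, ih,
      Finset.sum_powerset_insert hi]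
    ring

/-- The `(2, 4)` hypercontractive inequality of Bonami. -/
lemma expect_walshSum_pow_four_le (J : Finset (Fin n)) (c : Finset (Fin n) → ℝ) :
    expect (fun x => walshSum J c x ^ 4) ≤ (∑ S ∈ J.powerset, 3 ^ S.card * c S ^ 2) ^ 2 := by
  induction J using Finset.induction_on generalizing c with
  | empty => simp [walshSum, walsh, expect_const, ← pow_mul]
  | insert i J hi ih =>
    set d : Finset (Fin n) → ℝ := fun S => c (insert i S) with hd
    have hodd : expect (fun x => walsh {i} x *
        (walshSum J c x ^ 3 * walshSum J d x + walshSum J c x * walshSum J d x ^ 3)) = 0 :=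
      expect_eq_zero_of_comp_perm (flipAt i) fun x => by
        simp only [walsh_singleton_flipAt, walshSum_flipAt hi]; ring
    have key : (fun x => walshSum (insert i J) c x ^ 4) = fun x =>
        ((walshSum J c x ^ 4 + walshSum J d x ^ 4) +
        6 * (walshSum J c x ^ 2 * walshSum J d x ^ 2)) +
        4 * (walsh {i} x *
        (walshSum J c x ^ 3 * walshSum J d x + walshSum J c x * walshSum J d x ^ 3)) := by
      funext x
      rw [walshSum_insert hi, ← hd]
      linear_combination (6 * walshSum J c x ^ 2 * walshSum J d x ^ 2 +
        4 * walsh {i} x * walshSum J c x * walshSum J d x ^ 3 +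
        (walsh {i} x ^ 2 + 1) * walshSum J d x ^ 4) * walsh_singleton_sq i x
    have hcs := expect_mul_sq_le (fun x => walshSum J c x ^ 2) (fun x => walshSum J d x ^ 2)
    simp only [← pow_mul] at hcs
    norm_num at hcs
    have hsum : ∑ S ∈ (insert i J).powerset, (3 : ℝ) ^ S.card * c S ^ 2 =
        ∑ S ∈ J.powerset, 3 ^ S.card * c S ^ 2 + 3 * ∑ S ∈ J.powerset, 3 ^ S.card * d S ^ 2 := by
      rw [Finset.sum_powerset_insert hi, Finset.mul_sum]
      congr 1
      refine Finset.sum_congr rfl fun S hS => ?_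
      rw [Finset.card_insert_of_notMem fun h => hi (Finset.mem_powerset.mp hS h), pow_succ]
      ring
    have ha := ih c
    have hb := ih d
    have hα : 0 ≤ ∑ S ∈ J.powerset, (3 : ℝ) ^ S.card * c S ^ 2 :=
      Finset.sum_nonneg fun S _ => by positivity
    have hβ : 0 ≤ ∑ S ∈ J.powerset, (3 : ℝ) ^ S.card * d S ^ 2 :=
      Finset.sum_nonneg fun S _ => by positivity
    rw [key, expect_add, expect_add, expect_add, expect_const_mul, expect_const_mul, hodd, hsum]
    set α := ∑ S ∈ J.powerset, (3 : ℝ) ^ S.card * c S ^ 2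
    set β := ∑ S ∈ J.powerset, (3 : ℝ) ^ S.card * d S ^ 2
    have hab : expect (fun x => walshSum J c x ^ 2 * walshSum J d x ^ 2) ≤ α * β := by
      refine le_of_sq_le_sq (hcs.trans ?_) (by positivity)
      rw [mul_pow]
      exact mul_le_mul ha hb (expect_nonneg fun x => by positivity) (by positivity)
    -- The claim is now `α² + 6αβ + β² ≤ (α + 3β)²`; matching the cross term `6αβ` is what fixes the
    -- weight 3 per coordinate.
    nlinarith [sq_nonneg β]

/-! ### The noise operator in the Fourier basis. -/

/-- Each factor of the kernel is `(1 + (1 - 2ε) W_{i}(y) W_{i}(x)) / 2`; expanding the product over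
subsets diagonalises the operator. -/
lemma noise_eq_walshSum (ε : ℝ) (f : (Fin n → Bool) → ℝ) (x : Fin n → Bool) :
    noise ε f x = walshSum Finset.univ (fun S => (1 - 2 * ε) ^ S.card * fourier f S) x := by
  have hker (y : Fin n → Bool) : (∏ i, (if y i = x i then 1 - ε else ε)) =
      (∑ S : Finset (Fin n), (1 - 2 * ε) ^ S.card * walsh S y * walsh S x) / 2 ^ n := by
    have h1 (i : Fin n) : (if y i = x i then 1 - ε else ε) =
        (1 + (1 - 2 * ε) * (if y i then (-1 : ℝ) else 1) * (if x i then (-1 : ℝ) else 1)) / 2 := by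
      cases y i <;> cases x i <;> simp <;> ring
    simp_rw [h1]
    rw [Finset.prod_div_distrib, Finset.prod_one_add]
    simp only [walsh, Finset.prod_mul_distrib, Finset.prod_const, Finset.powerset_univ,
      Finset.card_univ, Fintype.card_fin]
  unfold noise walshSum fourier expect
  simp_rw [hker, Finset.powerset_univ, Finset.sum_div, Finset.sum_mul, Finset.mul_sum]
  rw [Finset.sum_comm]
  refine Finset.sum_congr rfl fun S _ => ?_
  rw [Finset.sum_mul]
  refine Finset.sum_congr rfl fun y _ => ?_
  ring

lemma noise_zero (f : (Fin n → Bool) → ℝ) : noise 0 f = f := by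
  funext x
  unfold noise
  rw [Finset.sum_eq_single x]
  · simp
  · intro y _ hy
    obtain ⟨i, hi⟩ := Function.ne_iff.mp hy
    rw [Finset.prod_eq_zero (Finset.mem_univ i) (by simp [hi]), zero_mul]
  · simp

lemma expect_sq_eq_sum_fourier_sq (f : (Fin n → Bool) → ℝ) :
    expect (fun x => f x ^ 2) = ∑ S, fourier f S ^ 2 := by
  have h (x) : f x = walshSum Finset.univ (fourier f) x := by
    conv_lhs => rw [← noise_zero f]
    rw [noise_eq_walshSum]
    simp
  rw [← Finset.powerset_univ, ← expect_walshSum_sq]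
  simp only [← h]

lemma fourier_empty (f : (Fin n → Bool) → ℝ) : fourier f ∅ = expect f := by
  simp [fourier, walsh]

lemma expect_walshSum (J : Finset (Fin n)) (c : Finset (Fin n) → ℝ) :
    expect (walshSum J c) = c ∅ := by
  induction J using Finset.induction_on generalizing c with
  | empty =>
    have : walshSum ∅ c = fun _ => c ∅ := by funext x; simp [walshSum, walsh]
    rw [this, expect_const]
  | insert i J hi ih =>
    have hodd : expect (fun x => walsh {i} x * walshSum J (fun S => c (insert i S)) x) = 0 :=
      expect_eq_zero_of_comp_perm (flipAt i) fun x => by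
        simp only [walsh_singleton_flipAt, walshSum_flipAt hi]; ring
    have key : walshSum (insert i J) c = fun x =>
        walshSum J c x + walsh {i} x * walshSum J (fun S => c (insert i S)) x :=
      funext fun x => walshSum_insert hi c x
    rw [key, expect_add, hodd, add_zero]
    exact ih c

lemma expect_noise (ε : ℝ) (f : (Fin n → Bool) → ℝ) : expect (noise ε f) = expect f := by
  rw [funext (noise_eq_walshSum ε f), expect_walshSum]
  simp [fourier_empty]

lemma noise_nonneg {ε : ℝ} (h0 : 0 ≤ ε) (h1 : ε ≤ 1) {f : (Fin n → Bool) → ℝ}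
    (hf : ∀ x, 0 ≤ f x) (x : Fin n → Bool) : 0 ≤ noise ε f x :=
  Finset.sum_nonneg fun y _ => mul_nonneg
    (Finset.prod_nonneg fun i _ => by split_ifs <;> linarith) (hf y)

/-! ### Pointwise logarithm bounds. -/

/-- The difference of the two sides has derivative `t³ / (1 + t)`, which has the sign of `t`, so its
minimum is the value 0 at `t = 0`. -/
lemma log_one_add_le {h : ℝ} (hh : -1 < h) : Real.log (1 + h) ≤ h - h ^ 2 / 2 + h ^ 3 / 3 := by
  have hder (t : ℝ) (ht : -1 < t) : HasDerivAt
      (fun t => t - t ^ 2 / 2 + t ^ 3 / 3 - Real.log (1 + t)) (t ^ 3 / (1 + t)) t := by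
    have hne : 1 + t ≠ 0 := by linarith
    refine ((((hasDerivAt_id t).sub ((hasDerivAt_pow 2 t).div_const 2)).add
      ((hasDerivAt_pow 3 t).div_const 3)).sub
      (((hasDerivAt_id t).const_add 1).log hne)).congr_deriv ?_
    simp only [id_eq]
    push_cast
    field_simp
    ring
  suffices 0 - 0 ^ 2 / 2 + 0 ^ 3 / 3 - Real.log (1 + 0) ≤
      h - h ^ 2 / 2 + h ^ 3 / 3 - Real.log (1 + h) by
    norm_num at this
    linarith
  rcases le_total 0 h with h0 | h0
  · refine monotoneOn_of_deriv_nonneg (convex_Icc 0 h)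
      (fun t ht => (hder t (by linarith [ht.1])).continuousAt.continuousWithinAt)
      (fun t ht => (hder t ?_).differentiableAt.differentiableWithinAt) (fun t ht => ?_)
      (Set.left_mem_Icc.mpr h0) (Set.right_mem_Icc.mpr h0) h0
    · rw [interior_Icc] at ht; linarith [ht.1]
    · rw [interior_Icc] at ht
      have := ht.1
      rw [(hder t (by linarith)).deriv]
      positivity
  · refine antitoneOn_of_deriv_nonpos (convex_Icc h 0)
      (fun t ht => (hder t (by linarith [ht.1])).continuousAt.continuousWithinAt)
      (fun t ht => (hder t ?_).differentiableAt.differentiableWithinAt) (fun t ht => ?_)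
      (Set.left_mem_Icc.mpr h0) (Set.right_mem_Icc.mpr h0) h0
    · rw [interior_Icc] at ht; linarith [ht.1]
    · rw [interior_Icc] at ht
      have := ht.1
      rw [(hder t (by linarith)).deriv]
      exact div_nonpos_of_nonpos_of_nonneg (by nlinarith [sq_nonneg t, ht.2]) (by linarith)

lemma one_add_mul_log_le {h : ℝ} (hh : -1 ≤ h) :
    (1 + h) * Real.log (1 + h) ≤ h + h ^ 2 / 2 - h ^ 3 / 6 + h ^ 4 / 3 := by
  -- The endpoint is needed because `T_ε f` may vanish; there `0 * Real.log 0 = 0`.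
  rcases hh.eq_or_lt with rfl | h1
  · norm_num
  · calc (1 + h) * Real.log (1 + h) ≤ (1 + h) * (h - h ^ 2 / 2 + h ^ 3 / 3) :=
          mul_le_mul_of_nonneg_left (log_one_add_le h1) (by linarith)
      _ = _ := by ring

lemma ent_mul_log_two (g : (Fin n → Bool) → ℝ) : ent g * Real.log 2 =
    expect (fun x => g x * Real.log (g x)) - expect g * Real.log (expect g) := by
  have h2 : Real.log 2 ≠ 0 := (Real.log_pos one_lt_two).ne'
  have h : (fun x => g x * Real.logb 2 (g x)) =
      fun x => (Real.log 2)⁻¹ * (g x * Real.log (g x)) := by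
    funext x
    rw [Real.logb]
    ring
  rw [ent, h, expect_const_mul, Real.logb]
  field_simp

/-! ### Decomposition by Fourier level. -/

/-- The part of `c` that is supported on the sets of cardinality in `p`. -/
def levelPart (p : ℕ → Prop) [DecidablePred p] (c : Finset (Fin n) → ℝ) (S : Finset (Fin n)) : ℝ :=
  if p S.card then c S else 0

lemma walshSum_levelPart_add {p q r : ℕ → Prop} [DecidablePred p] [DecidablePred q]
    [DecidablePred r] (hr : ∀ k, r k ↔ p k ∨ q k) (hpq : ∀ k, p k → ¬ q k) (J : Finset (Fin n))
    (c : Finset (Fin n) → ℝ) (x : Fin n → Bool) :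
    walshSum J (levelPart r c) x =
      walshSum J (levelPart p c) x + walshSum J (levelPart q c) x := by
  simp only [walshSum, ← Finset.sum_add_distrib]
  refine Finset.sum_congr rfl fun S _ => ?_
  have h1 := hr S.card
  have h2 := hpq S.card
  by_cases hp : p S.card <;> by_cases hq : q S.card <;> simp_all [levelPart]

lemma expect_walshSum_levelPart_sq_add {p q r : ℕ → Prop} [DecidablePred p] [DecidablePred q]
    [DecidablePred r] (hr : ∀ k, r k ↔ p k ∨ q k) (hpq : ∀ k, p k → ¬ q k) (J : Finset (Fin n))
    (c : Finset (Fin n) → ℝ) :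
    expect (fun x => walshSum J (levelPart r c) x ^ 2) =
      expect (fun x => walshSum J (levelPart p c) x ^ 2) +
        expect (fun x => walshSum J (levelPart q c) x ^ 2) := by
  simp only [expect_walshSum_sq, ← Finset.sum_add_distrib]
  refine Finset.sum_congr rfl fun S _ => ?_
  have h1 := hr S.card
  have h2 := hpq S.card
  by_cases hp : p S.card <;> by_cases hq : q S.card <;> simp_all [levelPart]

lemma walshSum_levelPart_zero (c : Finset (Fin n) → ℝ) (x : Fin n → Bool) :
    walshSum Finset.univ (levelPart (· = 0) c) x = c ∅ := by
  simp [walshSum, levelPart, walsh]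

lemma expect_walshSum_levelPart_one_sq (c : Finset (Fin n) → ℝ) :
    expect (fun x => walshSum Finset.univ (levelPart (· = 1) c) x ^ 2) = ∑ k, c {k} ^ 2 := by
  rw [expect_walshSum_sq]
  simp only [levelPart, ite_pow, Finset.powerset_univ]
  norm_num
  rw [← Finset.sum_filter, ← Finset.powerset_univ, ← Finset.powersetCard_eq_filter,
    Finset.powersetCard_one, Finset.sum_map]
  rfl

/-- A linear form is odd under flipping all coordinates. This removes the potential contribution of
order `λ^(3/2)`. -/
lemma expect_walshSum_levelPart_one_cube (c : Finset (Fin n) → ℝ) :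
    expect (fun x => walshSum Finset.univ (levelPart (· = 1) c) x ^ 3) = 0 := by
  refine expect_eq_zero_of_comp_perm flipAll fun x => ?_
  have h : walshSum Finset.univ (levelPart (· = 1) c) (flipAll x) =
      -walshSum Finset.univ (levelPart (· = 1) c) x := by
    rw [walshSum, walshSum, ← Finset.sum_neg_distrib]
    refine Finset.sum_congr rfl fun S _ => ?_
    rw [walsh_flipAll, levelPart]
    split_ifs with hS
    · rw [hS]; ring
    · ring
  rw [h]
  ring

/-- The weight `w` is 1 for second moments and `3 ^ k` for the Bonami bound. -/
lemma sum_levelPart_sq_le (f : (Fin n → Bool) → ℝ) (p : ℕ → Prop) [DecidablePred p] {r b : ℝ}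
    {w : ℕ → ℝ} (hb : 0 ≤ b) (h : ∀ k, p k → w k * (r ^ k) ^ 2 ≤ b) :
    ∑ S : Finset (Fin n), w S.card * levelPart p (fun S => r ^ S.card * fourier f S) S ^ 2 ≤
      b * expect (fun x => f x ^ 2) := by
  rw [expect_sq_eq_sum_fourier_sq, Finset.mul_sum]
  refine Finset.sum_le_sum fun S _ => ?_
  unfold levelPart
  split_ifs with hS
  · have := mul_le_mul_of_nonneg_right (h _ hS) (sq_nonneg (fourier f S))
    linarith
  · simp only [ne_eq, OfNat.ofNat_ne_zero, not_false_eq_true, zero_pow, mul_zero]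
    positivity

lemma expect_walshSum_levelPart_sq_le (f : (Fin n → Bool) → ℝ) (p : ℕ → Prop) [DecidablePred p]
    {r b : ℝ} (hb : 0 ≤ b) (h : ∀ k, p k → (r ^ k) ^ 2 ≤ b) :
    expect (fun x => walshSum Finset.univ
      (levelPart p fun S => r ^ S.card * fourier f S) x ^ 2) ≤ b * expect (fun x => f x ^ 2) := by
  rw [expect_walshSum_sq, Finset.powerset_univ]
  simpa using sum_levelPart_sq_le f p (w := fun _ => 1) hb (by simpa using h)

lemma expect_walshSum_levelPart_pow_four_le (f : (Fin n → Bool) → ℝ) (p : ℕ → Prop)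
    [DecidablePred p] (hp : ¬ p 0) {r : ℝ} (hr : 3 * r ^ 2 ≤ 1) :
    expect (fun x => walshSum Finset.univ
      (levelPart p fun S => r ^ S.card * fourier f S) x ^ 4) ≤
      9 * (r ^ 2) ^ 2 * expect (fun x => f x ^ 2) ^ 2 := by
  refine (expect_walshSum_pow_four_le _ _).trans ?_
  rw [Finset.powerset_univ,
    show 9 * (r ^ 2) ^ 2 * expect (fun x => f x ^ 2) ^ 2 =
      (3 * r ^ 2 * expect (fun x => f x ^ 2)) ^ 2 by ring]
  refine pow_le_pow_left₀ (Finset.sum_nonneg fun S _ => by positivity)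
    (sum_levelPart_sq_le f p (by positivity) fun k hk => ?_) 2
  rw [← pow_mul, mul_comm k 2, pow_mul, ← mul_pow]
  -- Excluding level 0 gives `(3r²)^k ≤ 3r²`, hence a fourth moment of order `r⁴`.
  exact pow_le_of_le_one (by positivity) hr fun h => hp (h ▸ hk)

lemma expect_noise_sq_le {ε : ℝ} (h0 : 0 ≤ ε) (h1 : ε ≤ 1) (f : (Fin n → Bool) → ℝ) :
    expect (fun x => noise ε f x ^ 2) ≤ expect (fun x => f x ^ 2) := by
  simp only [noise_eq_walshSum]
  rw [expect_walshSum_sq, Finset.powerset_univ, expect_sq_eq_sum_fourier_sq]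
  refine Finset.sum_le_sum fun S _ => ?_
  rw [mul_pow, ← pow_mul, mul_comm S.card 2, pow_mul]
  exact mul_le_of_le_one_left (sq_nonneg _) (pow_le_one₀ (sq_nonneg _) (by nlinarith))

/-! ### Entropy bounds for densities. -/

/-- With `h = l + q`, factor `h³ - l³ = q (h² + h l + l²)` and apply AM-GM to the two factors. -/
lemma neg_cube_le (l q : ℝ) :
    -(l + q) ^ 3 ≤ -l ^ 3 + (1 / 2 * q ^ 2 + 9 / 4 * ((l + q) ^ 4 + l ^ 4)) := by
  have h1 : ((l + q) ^ 2 + (l + q) * l + l ^ 2) ^ 2 ≤ 9 / 2 * ((l + q) ^ 4 + l ^ 4) := by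
    generalize l + q = h
    have h2 : h ^ 2 + h * l + l ^ 2 ≤ 3 / 2 * (h ^ 2 + l ^ 2) := by nlinarith [sq_nonneg (h - l)]
    have h3 : 0 ≤ h ^ 2 + h * l + l ^ 2 := by nlinarith [sq_nonneg (h + l)]
    nlinarith [sq_nonneg (h ^ 2 - l ^ 2)]
  nlinarith [sq_nonneg (q + ((l + q) ^ 2 + (l + q) * l + l ^ 2))]

/-- The entropy bound at small correlation for a density. -/
lemma ent_noise_mul_log_two_le {f : (Fin n → Bool) → ℝ} (hf : ∀ x, 0 ≤ f x)
    (h1 : expect f = 1) {ε : ℝ} (hε0 : 0 ≤ ε) (hε1 : ε ≤ 1) (hε : 3 * (1 - 2 * ε) ^ 2 ≤ 1) :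
    ent (noise ε f) * Real.log 2 ≤
      1 / 2 * ((1 - 2 * ε) ^ 2 * ∑ k, fourier f {k} ^ 2) +
        7 / 12 * ((1 - 2 * ε) ^ 2) ^ 2 * expect (fun x => f x ^ 2) +
        39 / 4 * ((1 - 2 * ε) ^ 2) ^ 2 * expect (fun x => f x ^ 2) ^ 2 := by
  set r := 1 - 2 * ε with hr
  set c : Finset (Fin n) → ℝ := fun S => r ^ S.card * fourier f S with hc
  set h := walshSum Finset.univ (levelPart (fun k => 0 < k) c) with hh
  set l := walshSum Finset.univ (levelPart (· = 1) c) with hl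
  set q := walshSum Finset.univ (levelPart (fun k => 2 ≤ k) c) with hq
  set A := expect (fun x => f x ^ 2)
  have hlq (x) : h x = l x + q x :=
    walshSum_levelPart_add (fun k => by omega) (fun k => by omega) _ _ _
  have hg (x) : noise ε f x = 1 + h x := by
    have := walshSum_levelPart_add (p := (· = 0)) (q := fun k => 0 < k) (r := fun _ => True)
      (fun k => by simp; omega) (fun k => by omega) Finset.univ c x
    have htrue : levelPart (fun _ => True) c = c := by funext S; simp [levelPart]
    rw [walshSum_levelPart_zero, htrue] at this
    rw [noise_eq_walshSum, ← hr, hh]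
    simpa [hc, fourier_empty, h1] using this
  have hg1 : expect (noise ε f) = 1 := by rw [expect_noise, h1]
  have hEh : expect h = 0 := by rw [hh, expect_walshSum]; simp [levelPart]
  have hEh2 : expect (fun x => h x ^ 2) =
      r ^ 2 * ∑ k, fourier f {k} ^ 2 + expect (fun x => q x ^ 2) := by
    have h3 := expect_walshSum_levelPart_sq_add (p := (· = 1)) (q := fun k => 2 ≤ k)
      (r := fun k => 0 < k) (fun k => by omega) (fun k => by omega) Finset.univ c
    have h4 := expect_walshSum_levelPart_one_sq c
    simp only [hc, Finset.card_singleton, pow_one, mul_pow, ← Finset.mul_sum] at h4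
    rw [← h4]
    exact h3
  have hr1 : r ^ 2 ≤ 1 := by linarith [sq_nonneg r]
  have hEq2 : expect (fun x => q x ^ 2) ≤ (r ^ 2) ^ 2 * A :=
    expect_walshSum_levelPart_sq_le f _ (by positivity) fun k hk => by
      rw [← pow_mul, mul_comm k 2, pow_mul]
      exact pow_le_pow_of_le_one (sq_nonneg r) hr1 hk
  have hEh4 : expect (fun x => h x ^ 4) ≤ 9 * (r ^ 2) ^ 2 * A ^ 2 :=
    expect_walshSum_levelPart_pow_four_le f _ (by simp) hε
  have hEl4 : expect (fun x => l x ^ 4) ≤ 9 * (r ^ 2) ^ 2 * A ^ 2 :=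
    expect_walshSum_levelPart_pow_four_le f _ (by simp) hε
  have hEl3 : expect (fun x => l x ^ 3) = 0 := expect_walshSum_levelPart_one_cube c
  -- One sixth of `neg_cube_le` is added to the quartic bound: `17/24 = 1/3 + 3/8`.
  have hpt (x) : noise ε f x * Real.log (noise ε f x) ≤
      h x + (1 / 2 * h x ^ 2 + (-1 / 6 * l x ^ 3 + (1 / 12 * q x ^ 2 +
        (17 / 24 * h x ^ 4 + 3 / 8 * l x ^ 4)))) := by
    have h5 := noise_nonneg hε0 hε1 hf x
    rw [hg] at h5 ⊢
    have h6 := one_add_mul_log_le (h := h x) (by linarith)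
    have h7 := neg_cube_le (l x) (q x)
    rw [← hlq] at h7
    linarith
  rw [ent_mul_log_two, hg1, Real.log_one, mul_zero, sub_zero]
  refine (expect_mono hpt).trans ?_
  simp only [expect_add, expect_const_mul]
  rw [hEl3, hEh2]
  have h8 : expect (fun x => h x) = 0 := hEh
  rw [h8]
  linarith

/-- The entropy of a density is at most its second moment. -/
lemma ent_noise_mul_log_two_le_expect_sq {f : (Fin n → Bool) → ℝ} (hf : ∀ x, 0 ≤ f x)
    (h1 : expect f = 1) {ε : ℝ} (hε0 : 0 ≤ ε) (hε1 : ε ≤ 1) :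
    ent (noise ε f) * Real.log 2 ≤ expect (fun x => f x ^ 2) := by
  rw [ent_mul_log_two, expect_noise, h1, Real.log_one, mul_zero, sub_zero]
  refine le_trans (expect_mono fun x => ?_) (expect_noise_sq_le hε0 hε1 f)
  have h2 := noise_nonneg hε0 hε1 hf x
  rw [sq]
  exact mul_le_mul_of_nonneg_left (Real.log_le_self h2) h2

lemma ent_noise_le_of_expect_eq_one {f : (Fin n → Bool) → ℝ} (hf : ∀ x, 0 ≤ f x)
    (h1 : expect f = 1) {ε l : ℝ} (hε0 : 0 ≤ ε) (hε1 : ε ≤ 1 / 2) (hl : l = (1 - 2 * ε) ^ 2) :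
    ent (noise ε f) ≤ 1 / (2 * Real.log 2) * (∑ k : Fin n, fourier f {k} ^ 2) * l
      + 9 / Real.log 2 * (expect (fun x => f x ^ 2) * l ^ ((4 : ℝ) / 3))
      + 10 / Real.log 2 * (expect (fun x => f x ^ 2) ^ 2 * l ^ 2) := by
  have hlog : 0 < Real.log 2 := Real.log_pos one_lt_two
  have hl0 : 0 ≤ l := hl ▸ sq_nonneg _
  have hl1 : l ≤ 1 := by rw [hl]; nlinarith
  have hpow : l ^ 2 ≤ l ^ ((4 : ℝ) / 3) := by
    rw [← Real.rpow_natCast]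
    exact Real.rpow_le_rpow_of_exponent_ge_of_imp hl0 hl1 (by norm_num) (by norm_num)
  have hA : 0 ≤ expect (fun x => f x ^ 2) := expect_nonneg fun x => sq_nonneg _
  have hAl := mul_le_mul_of_nonneg_left hpow hA
  have hAl2 : 0 ≤ expect (fun x => f x ^ 2) * l ^ 2 := by positivity
  have hA2 : 0 ≤ expect (fun x => f x ^ 2) ^ 2 * l ^ 2 := by positivity
  have hW : 0 ≤ l * ∑ k : Fin n, fourier f {k} ^ 2 :=
    mul_nonneg hl0 (Finset.sum_nonneg fun k _ => sq_nonneg _)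
  suffices ent (noise ε f) * Real.log 2 ≤ 1 / 2 * (l * ∑ k : Fin n, fourier f {k} ^ 2)
      + 9 * (expect (fun x => f x ^ 2) * l ^ ((4 : ℝ) / 3))
      + 10 * (expect (fun x => f x ^ 2) ^ 2 * l ^ 2) by
    refine ((le_div_iff₀ hlog).mpr this).trans_eq ?_
    field_simp
  rcases le_total (3 * l) 1 with h3 | h3
  · have := ent_noise_mul_log_two_le hf h1 hε0 (by linarith) (hl ▸ h3)
    rw [← hl] at this
    linarith
  · have := ent_noise_mul_log_two_le_expect_sq hf h1 hε0 (by linarith)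
    -- This case, `3 l ≥ 1`, is the source of the constant 9.
    have h9 : 1 ≤ 9 * l ^ 2 := by nlinarith
    have := mul_le_mul_of_nonneg_left h9 hA
    linarith

/-! ### Homogeneity and reduction to densities. -/

lemma noise_const_mul (ε a : ℝ) (f : (Fin n → Bool) → ℝ) :
    noise ε (fun x => a * f x) = fun x => a * noise ε f x := by
  funext x
  simp only [noise, Finset.mul_sum]
  exact Finset.sum_congr rfl fun y _ => by ring

lemma fourier_const_mul (a : ℝ) (f : (Fin n → Bool) → ℝ) (S : Finset (Fin n)) :
    fourier (fun x => a * f x) S = a * fourier f S := by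
  simp only [fourier, mul_assoc, expect_const_mul]

/-- The entropy is homogeneous of degree one. -/
lemma ent_const_mul {a : ℝ} (ha : a ≠ 0) {g : (Fin n → Bool) → ℝ} (hg : expect g ≠ 0) :
    ent (fun x => a * g x) = a * ent g := by
  have h : (fun x => a * g x * Real.logb 2 (a * g x)) = fun x =>
      a * (g x * Real.logb 2 (g x)) + a * Real.logb 2 a * g x := by
    funext x
    by_cases hx : g x = 0
    · simp [hx]
    · rw [Real.logb_mul ha hx]
      ring
  rw [ent, h, expect_add, expect_const_mul, expect_const_mul, expect_const_mul,
    Real.logb_mul ha hg, ent]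
  ring

end BoolCube

theorem lemma1p3 :
    ∃ C₁ C₂ : ℝ, 0 < C₁ ∧ 0 < C₂ ∧
      ∀ (n : ℕ) (f : (Fin n → Bool) → ℝ), (∀ x, 0 ≤ f x) → f ≠ 0 →
      ∀ ε l : ℝ, 0 ≤ ε → ε ≤ 1 / 2 → l = (1 - 2 * ε) ^ 2 →
        BoolCube.ent (BoolCube.noise ε f) ≤
          1 / BoolCube.expect f *
              (1 / (2 * Real.log 2) * ∑ k : Fin n, BoolCube.fourier f {k} ^ 2) * l
            + C₁ * (BoolCube.expect (fun x => f x ^ 2) / BoolCube.expect f *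
                l ^ ((4 : ℝ) / 3))
            + C₂ * (BoolCube.expect (fun x => f x ^ 2) ^ 2 / BoolCube.expect f ^ 3 *
                l ^ 2) := by
  have hlog : 0 < Real.log 2 := Real.log_pos one_lt_two
  refine ⟨9 / Real.log 2, 10 / Real.log 2, by positivity, by positivity, ?_⟩
  intro n f hf hf0 ε l hε0 hε1 hl
  have hm := BoolCube.expect_pos hf hf0
  set m := BoolCube.expect f
  have key := BoolCube.ent_noise_le_of_expect_eq_one (f := fun x => m⁻¹ * f x)
    (fun x => mul_nonneg (inv_nonneg.mpr hm.le) (hf x))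
    (by rw [BoolCube.expect_const_mul]; exact inv_mul_cancel₀ hm.ne') hε0 hε1 hl
  rw [BoolCube.noise_const_mul, BoolCube.ent_const_mul (inv_ne_zero hm.ne')
    (by rw [BoolCube.expect_noise]; exact hm.ne')] at key
  simp only [BoolCube.fourier_const_mul, mul_pow, BoolCube.expect_const_mul,
    ← Finset.mul_sum] at key
  rw [inv_mul_le_iff₀ hm] at key
  refine key.trans_eq ?_
  field_simp
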